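/- For a finite simplicial graph $\Gamma$, let $A_\Gamma$ be the right-angled Artin group with one generator for each vertex and a relator $[v,w]$ for each pair of adjacent vertices, and let the Bestvina--Brady group $H_\Gamma$ be the kernel of the homomorphism $A_\Gamma\to\mathbb Z$ sending every generator to $1$. For a set $S$ of vertices, let $H_S$ denote the Bestvina--Brady group of the subgraph of $\Gamma$ induced on $S$. A group $G$ splits over $\mathbb Z^m$ if it has a subgroup $C\cong\mathbb Z^m$ such that $G$ is an amalgamated product $A*_CB$ with $A\neq C\neq B$, or an HNN extension $A*_C$. Let $\Gamma$ be a finite connected simplicial graph whose flag complex is simply connected, and suppose that $\Gamma$ has a separating clique $K$ with $n\ge 2$ vertices, i.e. $K$ is a set of $n$ pairwise adjacent vertices and $\Gamma\setminus K$ is disconnected. Then: 1. $A_\Gamma$ splits over $\mathbb Z^{n}$. 2. $H_\Gamma$ splits over $\mathbb Z^{n-1}$. 3. More precisely, $H_K\cong\mathbb Z^{n-1}$, and whenever the vertex set of $\Gamma\setminus K$ is a disjoint union of two nonempty sets $\Gamma_1$, $\Gamma_2$ with no edge of $\Gamma$ between them, the canonical homomorphisms from $H_{\Gamma_1\cup K}$,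 $H_{\Gamma_2\cup K}$ and $H_K$ to $H_\Gamma$ are injective and, identifying these groups with their images, $$H_\Gamma=H_{\Gamma_1\cup K}*_{H_K}H_{\Gamma_2\cup K},$$ with $H_K\neq H_{\Gamma_1\cup K}$ and $H_K\neq H_{\Gamma_2\cup K}$. -/

import Mathlib

/-! ### The flag complex of a graph and its geometric realization -/

/-- The flag complex on `Γ`: the simplices are the nonempty finite cliques of `Γ`. -/
def flagComplex {V : Type*} (Γ : SimpleGraph V) : AbstractSimplicialComplex V where
  faces := {s : Finset V | s.Nonempty ∧ Γ.IsClique (s : Set V)}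
  isRelLowerSet_faces := fun _ hs =>
    ⟨hs.1, fun _ hts ht => ⟨ht, hs.2.subset (Finset.coe_subset.mpr hts)⟩⟩
  singleton_mem := fun v => ⟨Finset.singleton_nonempty v, by simp⟩

/-- The geometric realization of a simplicial complex on a finite vertex set, in barycentric
coordinates and with the topology it inherits from `V → ℝ`. -/
def geomRealization {V : Type*} [Fintype V] (X : AbstractSimplicialComplex V) : Set (V → ℝ) :=
  {x | x ∈ stdSimplex ℝ V ∧ ∃ s : Finset V, s ∈ X.faces ∧ Function.support x = (s : Set V)}

/-- `K` is a separating clique of `Γ` with `n` vertices: deleting it leaves a graph which is not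
connected (the empty graph does not count as disconnected here). -/
def IsSeparatingNClique {V : Type*} (Γ : SimpleGraph V) (n : ℕ) (K : Finset V) : Prop :=
  Γ.IsNClique n K ∧ ¬ (Γ.induce ((K : Set V)ᶜ)).Preconnected

/-! ### Right-angled Artin groups and Bestvina--Brady groups -/

/-- The defining relators `[v, w]`, for `v` and `w` adjacent. -/
def raagRels {V : Type*} (Γ : SimpleGraph V) : Set (FreeGroup V) :=
  {r | ∃ v w : V, Γ.Adj v w ∧ r =
    FreeGroup.of v * FreeGroup.of w * (FreeGroup.of v)⁻¹ * (FreeGroup.of w)⁻¹}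

/-- The right-angled Artin group `A_Γ`. -/
abbrev RAAG {V : Type*} (Γ : SimpleGraph V) : Type _ := PresentedGroup (raagRels Γ)

/-- The homomorphism `A_Γ → ℤ` which sends every generator to `1`. -/
def raagHeight {V : Type*} (Γ : SimpleGraph V) : RAAG Γ →* Multiplicative ℤ :=
  PresentedGroup.toGroup (rels := raagRels Γ) (f := fun _ : V => Multiplicative.ofAdd (1 : ℤ)) (by
    rintro r ⟨v, w, -, rfl⟩
    simp)

/-- The Bestvina--Brady group `H_Γ`, the kernel of the height homomorphism. -/
def BestvinaBrady {V : Type*} (Γ : SimpleGraph V) : Subgroup (RAAG Γ) := (raagHeight Γ).ker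

/-- The canonical homomorphism `A_Δ → A_Γ` for the induced subgraph `Δ` of `Γ` on `S`. -/
def raagInduceMap {V : Type*} (Γ : SimpleGraph V) (S : Set V) : RAAG (Γ.induce S) →* RAAG Γ :=
  PresentedGroup.toGroup (rels := raagRels (Γ.induce S))
    (f := fun v : S => (PresentedGroup.of (v : V) : RAAG Γ)) (by
      rintro r ⟨v, w, hvw, rfl⟩
      have h : PresentedGroup.mk (raagRels Γ) (FreeGroup.of (v : V) * FreeGroup.of (w : V) *
          (FreeGroup.of (v : V))⁻¹ * (FreeGroup.of (w : V))⁻¹) = 1 :=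
        PresentedGroup.one_of_mem ⟨v, w, by simpa using hvw, rfl⟩
      simpa [PresentedGroup.of] using h)

theorem raagHeight_comp_induceMap {V : Type*} (Γ : SimpleGraph V) (S : Set V) :
    (raagHeight Γ).comp (raagInduceMap Γ S) = raagHeight (Γ.induce S) := by
  apply PresentedGroup.ext
  intro v
  simp [raagHeight, raagInduceMap]

/-- The canonical homomorphism `H_Δ → H_Γ` for the induced subgraph `Δ` of `Γ` on `S`. -/
def bbInduceMap {V : Type*} (Γ : SimpleGraph V) (S : Set V) :
    BestvinaBrady (Γ.induce S) →* BestvinaBrady Γ :=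
  ((raagInduceMap Γ S).comp (BestvinaBrady (Γ.induce S)).subtype).codRestrict (BestvinaBrady Γ)
    (fun x => by
      have hx : raagHeight (Γ.induce S) x = 1 := x.2
      rw [← raagHeight_comp_induceMap] at hx
      exact hx)

/-- `H_Δ` as a subgroup of `H_Γ`, for the induced subgraph `Δ` of `Γ` on `S`: the image of the
canonical homomorphism. -/
def bbSubgroup {V : Type*} (Γ : SimpleGraph V) (S : Set V) : Subgroup (BestvinaBrady Γ) :=
  (bbInduceMap Γ S).range

/-! ### Splittings of groups -/

/-- The two factors of an amalgam, as a family. -/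
def pairFamily {G : Type*} [Group G] (A B : Subgroup G) : Bool → Subgroup G
  | false => A
  | true => B

/-- `G = A *_C B`: the subgroup `C` is contained in the subgroups `A` and `B`, and the inclusions
of `A` and `B` into `G` induce an isomorphism from the amalgamated product onto `G`. -/
def IsAmalgam {G : Type*} [Group G] (A B C : Subgroup G) : Prop :=
  ∃ (h : ∀ i : Bool, C ≤ pairFamily A B i)
    (e : Monoid.PushoutI (fun i : Bool => Subgroup.inclusion (h i)) ≃* G),
    ∀ (i : Bool) (x : pairFamily A B i), e (Monoid.PushoutI.of i x) = (x : G)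

/-- `G = A *_C` is an HNN extension with base `A`, associated subgroups `C = C₁` and `C₂` of `A`
and identification `φ : C₁ ≃* C₂`; the inclusion of `A` is the canonical one. -/
def IsHNN {G : Type*} [Group G] (A C : Subgroup G) : Prop :=
  ∃ (C₁ C₂ : Subgroup A) (φ : C₁ ≃* C₂) (e : HNNExtension A C₁ C₂ φ ≃* G),
    (∀ a : A, e (HNNExtension.of a) = (a : G)) ∧ C₁.map A.subtype = C

/-- `G` splits (non-trivially) over its subgroup `C`. -/
def SplitsOver (G : Type*) [Group G] (C : Subgroup G) : Prop :=
  (∃ A B : Subgroup G, IsAmalgam A B C ∧ A ≠ C ∧ B ≠ C) ∨ ∃ A : Subgroup G, IsHNN A C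

/-- `G` splits over `ℤ^m`: it splits over a subgroup isomorphic to `ℤ^m`. -/
def SplitsOverZPow (G : Type*) [Group G] (m : ℕ) : Prop :=
  ∃ C : Subgroup G, Nonempty (C ≃* Multiplicative (Fin m → ℤ)) ∧ SplitsOver G C

/-! No edge joins `V₁` to `V₂`, so the presentation of A_Γ is the union of those of the two sides,
glued along K: A_Γ is the amalgam of the two side groups over A_K (`raag_isAmalgam`). Killing
generators retracts A_Γ onto each induced subgroup, so these embed. As K is nonempty, A_K already
surjects onto ℤ. In Bass–Serre terms H_Γ is then transitive on the edges of the tree, with the same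
quotient segment, so it is the amalgam of its intersections with the three groups.
`IsAmalgam.subgroupOf_ker` proves this algebraically, with reduced words for injectivity and a
factorization G = M·C for surjectivity. For a clique, A_K is ℤⁿ and H_K is its sum-zero hyperplane,
ℤⁿ⁻¹. Exponent sums show that the factors are proper. -/

open Function

/-! ### Reduced words and injectivity for amalgamated products -/

namespace Monoid.PushoutI

/-- Every element of an amalgamated product is the product of an element of the base group and a
reduced word. -/
theorem exists_reduced_eq {ι : Type*} {G : ι → Type*} {H : Type*} [∀ i, Group (G i)] [Group H]
    {φ : ∀ i, H →* G i} (hφ : ∀ i, Injective (φ i)) (x : PushoutI φ) :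
    ∃ (h : H) (w : CoprodI.Word G), Reduced φ w ∧ x = base φ h * ofCoprodI w.prod := by
  classical
  obtain ⟨d⟩ := NormalWord.transversal_nonempty φ hφ
  obtain ⟨w, rfl⟩ := (NormalWord.equiv (d := d)).symm.surjective x
  refine ⟨w.head, w.toWord, ?_, rfl⟩
  rintro ⟨i, g⟩ hg hr
  refine w.ne_one _ hg ?_
  -- A letter of a normal word is its own coset representative, whereas an element of the base group
  -- is represented by 1.
  have h₁ := ((d.compl i).equiv_snd_eq_self_iff_mem (one_mem _)).2 (w.normalized i g hg)
  have h₂ := ((d.compl i).coe_equiv_snd_eq_one_iff_mem (d.one_mem i)).2 hr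
  exact h₁.symm.trans h₂

/-- A morphism of amalgamated products is injective if it is injective on the base group and if the
preimage of the base group in each factor is the base group. -/
theorem injective_of_pullback {ι : Type*} {G G' : ι → Type*} {H H' : Type*}
    [∀ i, Group (G i)] [Group H] [∀ i, Group (G' i)] [Group H']
    {φ : ∀ i, H →* G i} {φ' : ∀ i, H' →* G' i}
    (hφ : ∀ i, Injective (φ i)) (hφ' : ∀ i, Injective (φ' i))
    (f : ∀ i, G i →* G' i) (k : H →* H') (hk : Injective k)
    (hpull : ∀ i g, f i g ∈ (φ' i).range → g ∈ (φ i).range)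
    (F : PushoutI φ →* PushoutI φ') (hF : ∀ i g, F (of i g) = of i (f i g))
    (hFb : ∀ h, F (base φ h) = base φ' (k h)) :
    Injective F := by
  rw [injective_iff_map_eq_one]
  intro x hx
  obtain ⟨h, w, hw, rfl⟩ := exists_reduced_eq hφ x
  let w' : CoprodI.Word G' :=
    { toList := w.toList.map fun p => ⟨p.1, f p.1 p.2⟩
      ne_one := by
        rintro l hl h1
        obtain ⟨p, hp, rfl⟩ := List.mem_map.1 hl
        -- A letter with trivial image maps into the base group, so it is excluded by `hpull` as
        -- well.
        exact hw p hp (hpull _ _ ⟨1, by simpa using h1.symm⟩)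
      chain_ne := by
        rw [List.isChain_map]
        exact w.chain_ne }
  have hw' : Reduced φ' w' := by
    intro g hg hr
    obtain ⟨p, hp, rfl⟩ := List.mem_map.1 hg
    exact hw p hp (hpull _ _ hr)
  have hprod : F (ofCoprodI w.prod) = ofCoprodI w'.prod := by
    simp only [CoprodI.Word.prod, map_list_prod, List.map_map, w']
    congr 1
    apply List.map_congr_left
    intro p _
    simp [hF]
  rw [map_mul, hFb, hprod] at hx
  have hmem : ofCoprodI w'.prod ∈ (base φ').range :=
    ⟨(k h)⁻¹, by rw [map_inv]; exact inv_eq_of_mul_eq_one_right hx⟩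
  have he := hw'.eq_empty_of_mem_range hφ' hmem
  have hl : w.toList = [] := by
    have : w'.toList = [] := by rw [he]; rfl
    simpa [w'] using this
  have hwe : w = CoprodI.Word.empty := by
    ext1
    exact hl
  rw [he] at hx
  subst hwe
  have hkh : k h = 1 := base_injective hφ' (by simpa using hx)
  have : h = 1 := hk (by simpa using hkh)
  simp [this]

end Monoid.PushoutI

/-! ### Internal amalgams and their restriction to kernels -/

section Amalgam

open Monoid

variable {G : Type*} [Group G]

/-- The canonical homomorphism from the amalgamated product of two subgroups. -/
def amalgamMap (A B C : Subgroup G) (h : ∀ i : Bool, C ≤ pairFamily A B i) :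
    PushoutI (fun i : Bool => Subgroup.inclusion (h i)) →* G :=
  PushoutI.lift (fun i => (pairFamily A B i).subtype) C.subtype (fun _ => rfl)

@[simp]
theorem amalgamMap_of {A B C : Subgroup G} (h : ∀ i : Bool, C ≤ pairFamily A B i) (i : Bool)
    (x : pairFamily A B i) : amalgamMap A B C h (PushoutI.of i x) = x :=
  PushoutI.lift_of (φ := fun i : Bool => Subgroup.inclusion (h i)) _ _ _ x

@[simp]
theorem amalgamMap_base {A B C : Subgroup G} (h : ∀ i : Bool, C ≤ pairFamily A B i) (c : C) :
    amalgamMap A B C h (PushoutI.base _ c) = c :=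
  PushoutI.lift_base (φ := fun i : Bool => Subgroup.inclusion (h i)) _ _ _ c

/-- By the universal property, any isomorphism compatible with the inclusions is the canonical map.
-/
theorem isAmalgam_iff_bijective {A B C : Subgroup G} :
    IsAmalgam A B C ↔ ∃ h, Bijective (amalgamMap A B C h) := by
  constructor
  · rintro ⟨h, e, he⟩
    refine ⟨h, ?_⟩
    have : amalgamMap A B C h = e.toMonoidHom := by
      apply PushoutI.hom_ext_nonempty
      intro i
      ext x
      simp [he]
    rw [this]
    exact e.bijective
  · rintro ⟨h, hb⟩
    exact ⟨h, MulEquiv.ofBijective _ hb, fun i x => amalgamMap_of h i x⟩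

theorem mem_pairFamily_subgroupOf {A B N : Subgroup G} {i : Bool} {x : N} :
    x ∈ pairFamily (A.subgroupOf N) (B.subgroupOf N) i ↔ (x : G) ∈ pairFamily A B i := by
  cases i <;> rfl

/-- An amalgamated product decomposition restricts to the kernel of a homomorphism which maps the
amalgamated subgroup onto the whole image. -/
theorem IsAmalgam.subgroupOf_ker {Q : Type*} [Group Q] {A B C : Subgroup G}
    (hG : IsAmalgam A B C) (φ : G →* Q) (hC : ∀ q, ∃ c ∈ C, φ c = q) :
    IsAmalgam (A.subgroupOf φ.ker) (B.subgroupOf φ.ker) (C.subgroupOf φ.ker) := by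
  obtain ⟨h, hinj, hsurj⟩ := isAmalgam_iff_bijective.1 hG
  have h' : ∀ i : Bool, C.subgroupOf φ.ker ≤
      pairFamily (A.subgroupOf φ.ker) (B.subgroupOf φ.ker) i := fun i x hx =>
    mem_pairFamily_subgroupOf.2 (h i hx)
  refine isAmalgam_iff_bijective.2 ⟨h', ?_, ?_⟩
  · let f : ∀ i : Bool, pairFamily (A.subgroupOf φ.ker) (B.subgroupOf φ.ker) i →*
        pairFamily A B i := fun i =>
      (φ.ker.subtype.comp (Subgroup.subtype _)).codRestrict _ fun x =>
        mem_pairFamily_subgroupOf.1 x.2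
    let k : C.subgroupOf φ.ker →* C :=
      (φ.ker.subtype.comp (Subgroup.subtype _)).codRestrict _ fun x => x.2
    let F : PushoutI (fun i : Bool => Subgroup.inclusion (h' i)) →*
        PushoutI (fun i : Bool => Subgroup.inclusion (h i)) :=
      PushoutI.lift (fun i => (PushoutI.of i).comp (f i)) ((PushoutI.base _).comp k) (by
        intro i
        ext x
        exact PushoutI.of_apply_eq_base (fun i : Bool => Subgroup.inclusion (h i)) i (k x))
    have hF : Injective F := by
      refine PushoutI.injective_of_pullback (fun i => Subgroup.inclusion_injective _)
        (fun i => Subgroup.inclusion_injective _) f k ?_ ?_ F ?_ ?_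
      · intro x y hxy
        exact Subtype.ext (Subtype.ext (congrArg (fun c : C => (c : G)) hxy))
      · rintro i g ⟨c, hc⟩
        have hc' : (c : G) = ((g : φ.ker) : G) :=
          congrArg (fun c : pairFamily A B i => (c : G)) hc
        exact ⟨⟨g, by rw [Subgroup.mem_subgroupOf, ← hc']; exact c.2⟩, rfl⟩
      · intro i g
        simp [F]
      · intro h
        simp [F]
    have hcomp : (amalgamMap A B C h).comp F = φ.ker.subtype.comp (amalgamMap _ _ _ h') := by
      apply PushoutI.hom_ext_nonempty
      intro i
      ext x
      simp only [F, MonoidHom.comp_apply, PushoutI.lift_of, amalgamMap_of]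
      rfl
    have hc : Injective (φ.ker.subtype.comp (amalgamMap _ _ _ h')) := by
      rw [← hcomp]
      exact hinj.comp hF
    exact Injective.of_comp (f := φ.ker.subtype) hc
  -- `M` is the image in G of the restricted amalgam; it has to contain the whole kernel.
  · set M : Subgroup G := (amalgamMap _ _ _ h').range.map φ.ker.subtype
    have hmem : ∀ (i : Bool) (x : G), x ∈ pairFamily A B i → φ x = 1 → x ∈ M := by
      intro i x hx h1
      refine ⟨⟨x, h1⟩, ⟨PushoutI.of i ⟨⟨x, h1⟩,
        mem_pairFamily_subgroupOf.2 hx⟩, amalgamMap_of h' i _⟩, rfl⟩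
    -- C lies in both factors, so conjugation by C preserves the part of each factor in the kernel.
    -- Hence M·C is closed under products.
    have hconj : ∀ c ∈ C, ∀ m ∈ M, c * m * c⁻¹ ∈ M := by
      rintro c hc _ ⟨_, ⟨y, rfl⟩, rfl⟩
      induction y using PushoutI.induction_on with
      | of i g =>
        have hg := mem_pairFamily_subgroupOf.1 g.2
        refine hmem i _ ?_ ?_
        · rw [amalgamMap_of]
          exact mul_mem (mul_mem (h i hc) hg) (inv_mem (h i hc))
        · have : φ ((g : φ.ker) : G) = 1 := (g : φ.ker).2
          simp [this]
      | base g =>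
        refine hmem true _ ?_ ?_
        · rw [amalgamMap_base]
          exact mul_mem (mul_mem (h _ hc) (h _ g.2)) (inv_mem (h _ hc))
        · have : φ ((g : φ.ker) : G) = 1 := (g : φ.ker).2
          simp [this]
      | mul x y hx hy =>
        have := mul_mem hx hy
        simpa [mul_assoc] using this
    have hfac : ∀ (i : Bool) (x : G), x ∈ pairFamily A B i → ∃ m ∈ M, ∃ c ∈ C, x = m * c := by
      intro i x hx
      obtain ⟨c, hc, hcx⟩ := hC (φ x)
      exact ⟨x * c⁻¹, hmem i _ (mul_mem hx (inv_mem (h i hc))) (by simp [hcx]), c, hc, by simp⟩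
    have hall : ∀ x : G, ∃ m ∈ M, ∃ c ∈ C, x = m * c := by
      intro x
      obtain ⟨y, rfl⟩ := hsurj x
      induction y using PushoutI.induction_on with
      | of i g => exact hfac i _ (by simp)
      | base g => exact hfac true _ (h _ (by simp))
      | mul x y hx hy =>
        obtain ⟨m₁, hm₁, c₁, hc₁, h₁⟩ := hx
        obtain ⟨m₂, hm₂, c₂, hc₂, h₂⟩ := hy
        refine ⟨m₁ * (c₁ * m₂ * c₁⁻¹), mul_mem hm₁ (hconj _ hc₁ _ hm₂), c₁ * c₂,
          mul_mem hc₁ hc₂, ?_⟩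
        rw [map_mul, h₁, h₂]
        group
    intro n
    -- Since n and m are in the kernel, so is c; being in C, it lies in `M`.
    obtain ⟨m, hm, c, hc, hn⟩ := hall n
    have hm1 : φ m = 1 := by
      obtain ⟨y, -, rfl⟩ := hm
      exact y.2
    have hn1 : φ (n : G) = 1 := n.2
    have hc1 : φ c = 1 := by
      rw [hn, map_mul, hm1, one_mul] at hn1
      exact hn1
    have hnM : (n : G) ∈ M := hn ▸ mul_mem hm (hmem true c (h _ hc) hc1)
    obtain ⟨y, ⟨z, hz⟩, hy⟩ := hnM
    exact ⟨z, hz.trans (Subtype.ext hy)⟩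

end Amalgam

/-! ### Right-angled Artin groups, Bestvina–Brady groups and their amalgams -/

section RAAG

open Monoid

variable {V : Type*} (Γ : SimpleGraph V)

theorem raag_commute {v w : V} (h : Γ.Adj v w) :
    Commute (PresentedGroup.of v : RAAG Γ) (PresentedGroup.of w) := by
  have h1 : PresentedGroup.mk (raagRels Γ) (FreeGroup.of v * FreeGroup.of w *
      (FreeGroup.of v)⁻¹ * (FreeGroup.of w)⁻¹) = 1 :=
    PresentedGroup.one_of_mem ⟨v, w, h, rfl⟩
  simp only [map_mul, map_inv] at h1
  rw [mul_inv_eq_one, mul_inv_eq_iff_eq_mul] at h1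
  exact h1

/-- The homomorphism from a right-angled Artin group given by images of the generators. -/
def raagLift {Q : Type*} [Group Q] (f : V → Q) (hf : ∀ v w, Γ.Adj v w → Commute (f v) (f w)) :
    RAAG Γ →* Q :=
  PresentedGroup.toGroup (rels := raagRels Γ) (f := f) (by
    rintro r ⟨v, w, hvw, rfl⟩
    simp only [map_mul, map_inv, FreeGroup.lift_apply_of]
    rw [mul_inv_eq_one, mul_inv_eq_iff_eq_mul]
    exact hf v w hvw)

@[simp]
theorem raagLift_of {Q : Type*} [Group Q] (f : V → Q)
    (hf : ∀ v w, Γ.Adj v w → Commute (f v) (f w)) (v : V) :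
    raagLift Γ f hf (PresentedGroup.of v) = f v :=
  PresentedGroup.toGroup.of _

@[simp]
theorem raagInduceMap_of (S : Set V) (v : S) :
    raagInduceMap Γ S (PresentedGroup.of v) = PresentedGroup.of (v : V) :=
  PresentedGroup.toGroup.of _

@[simp]
theorem raagHeight_of (v : V) : raagHeight Γ (PresentedGroup.of v) = Multiplicative.ofAdd 1 :=
  PresentedGroup.toGroup.of _

theorem of_mem_range_raagInduceMap {S : Set V} {v : V} (hv : v ∈ S) :
    (PresentedGroup.of v : RAAG Γ) ∈ (raagInduceMap Γ S).range :=
  ⟨PresentedGroup.of ⟨v, hv⟩, by simp⟩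

/-- Sending the generators outside `S` to 1 respects the relators and gives a left inverse. -/
theorem raagInduceMap_injective (S : Set V) : Injective (raagInduceMap Γ S) := by
  classical
  let r : RAAG Γ →* RAAG (Γ.induce S) :=
    raagLift Γ (fun v => if h : v ∈ S then PresentedGroup.of ⟨v, h⟩ else 1) (by
      intro v w hvw
      by_cases hv : v ∈ S
      · by_cases hw : w ∈ S
        · simp only [hv, hw, dite_true]
          exact raag_commute (Γ.induce S) (by simpa using hvw)
        · simp [hw]
      · simp [hv])
  have hr : r.comp (raagInduceMap Γ S) = MonoidHom.id _ := by
    apply PresentedGroup.ext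
    intro v
    simp [r]
  exact LeftInverse.injective (g := r) (DFunLike.congr_fun hr)

theorem range_raagInduceMap_mono {S T : Set V} (h : S ⊆ T) :
    (raagInduceMap Γ S).range ≤ (raagInduceMap Γ T).range := by
  have : raagInduceMap Γ S = (raagInduceMap Γ T).comp
      (raagLift (Γ.induce S) (fun v => PresentedGroup.of (Set.inclusion h v))
        (fun v w hvw => raag_commute (Γ.induce T) (by simpa using hvw))) := by
    apply PresentedGroup.ext
    intro v
    simp
  rw [this, MonoidHom.range_comp]
  exact Subgroup.map_le_range _ _

/-- The right-angled Artin group of a union of two induced subgraphs, with no edges outside of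
them, is the amalgamated product over the group of the intersection. -/
theorem raag_isAmalgam {S₁ S₂ T : Set V} (hT : S₁ ∩ S₂ = T) (hU : S₁ ∪ S₂ = Set.univ)
    (hadj : ∀ v w, Γ.Adj v w → (v ∈ S₁ ∧ w ∈ S₁) ∨ (v ∈ S₂ ∧ w ∈ S₂)) :
    IsAmalgam (raagInduceMap Γ S₁).range (raagInduceMap Γ S₂).range
      (raagInduceMap Γ T).range := by
  classical
  subst hT
  have h : ∀ i : Bool, (raagInduceMap Γ (S₁ ∩ S₂)).range ≤
      pairFamily (raagInduceMap Γ S₁).range (raagInduceMap Γ S₂).range i := by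
    rintro (_ | _)
    · exact range_raagInduceMap_mono Γ Set.inter_subset_left
    · exact range_raagInduceMap_mono Γ Set.inter_subset_right
  let j₁ : (raagInduceMap Γ S₁).range →* PushoutI (fun i : Bool => Subgroup.inclusion (h i)) :=
    PushoutI.of (φ := fun i : Bool => Subgroup.inclusion (h i)) false
  let j₂ : (raagInduceMap Γ S₂).range →* PushoutI (fun i : Bool => Subgroup.inclusion (h i)) :=
    PushoutI.of (φ := fun i : Bool => Subgroup.inclusion (h i)) true
  -- Both factors give a shared generator the same image, so `g` below does not depend on the side
  -- chosen.
  have hj : ∀ (v : V) (h₁ : v ∈ S₁) (h₂ : v ∈ S₂),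
      j₁ ⟨PresentedGroup.of v, of_mem_range_raagInduceMap Γ h₁⟩ =
        j₂ ⟨PresentedGroup.of v, of_mem_range_raagInduceMap Γ h₂⟩ := by
    intro v h₁ h₂
    let c : (raagInduceMap Γ (S₁ ∩ S₂)).range :=
      ⟨PresentedGroup.of v, of_mem_range_raagInduceMap Γ ⟨h₁, h₂⟩⟩
    exact (PushoutI.of_apply_eq_base (fun i : Bool => Subgroup.inclusion (h i)) false c).trans
      (PushoutI.of_apply_eq_base (fun i : Bool => Subgroup.inclusion (h i)) true c).symm
  have hor : ∀ v, v ∉ S₁ → v ∈ S₂ := fun v hv => by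
    have : v ∈ S₁ ∪ S₂ := hU ▸ Set.mem_univ v
    exact this.resolve_left hv
  let g : V → PushoutI (fun i : Bool => Subgroup.inclusion (h i)) := fun v =>
    if hv : v ∈ S₁ then j₁ ⟨PresentedGroup.of v, of_mem_range_raagInduceMap Γ hv⟩
    else j₂ ⟨PresentedGroup.of v, of_mem_range_raagInduceMap Γ (hor v hv)⟩
  have hg₁ : ∀ v (hv : v ∈ S₁),
      g v = j₁ ⟨PresentedGroup.of v, of_mem_range_raagInduceMap Γ hv⟩ := fun v hv => by
    simp [g, hv]
  have hg₂ : ∀ v (hv : v ∈ S₂),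
      g v = j₂ ⟨PresentedGroup.of v, of_mem_range_raagInduceMap Γ hv⟩ := fun v hv => by
    by_cases h₁ : v ∈ S₁
    · rw [hg₁ v h₁, hj v h₁ hv]
    · simp [g, h₁]
  let r : RAAG Γ →* PushoutI (fun i : Bool => Subgroup.inclusion (h i)) :=
    raagLift Γ g (by
      intro v w hvw
      rcases hadj v w hvw with ⟨hv, hw⟩ | ⟨hv, hw⟩
      · rw [hg₁ v hv, hg₁ w hw]
        exact Commute.map (Subtype.ext (raag_commute Γ hvw).eq) j₁
      · rw [hg₂ v hv, hg₂ w hw]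
        exact Commute.map (Subtype.ext (raag_commute Γ hvw).eq) j₂)
  refine isAmalgam_iff_bijective.2 ⟨h, ?_, ?_⟩
  · have e₁ : r.comp (raagInduceMap Γ S₁) = j₁.comp (raagInduceMap Γ S₁).rangeRestrict := by
      apply PresentedGroup.ext
      intro v
      simp only [MonoidHom.comp_apply, raagInduceMap_of, r, raagLift_of, hg₁ v v.2]
      exact congrArg j₁ (Subtype.ext (raagInduceMap_of Γ S₁ v).symm)
    have e₂ : r.comp (raagInduceMap Γ S₂) = j₂.comp (raagInduceMap Γ S₂).rangeRestrict := by
      apply PresentedGroup.ext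
      intro v
      simp only [MonoidHom.comp_apply, raagInduceMap_of, r, raagLift_of, hg₂ v v.2]
      exact congrArg j₂ (Subtype.ext (raagInduceMap_of Γ S₂ v).symm)
    have hr : r.comp (amalgamMap _ _ _ h) = MonoidHom.id _ := by
      apply PushoutI.hom_ext_nonempty
      rintro (_ | _)
      · ext ⟨_, y, rfl⟩
        simp only [MonoidHom.comp_apply, amalgamMap_of]
        exact DFunLike.congr_fun e₁ y
      · ext ⟨_, y, rfl⟩
        simp only [MonoidHom.comp_apply, amalgamMap_of]
        exact DFunLike.congr_fun e₂ y
    exact LeftInverse.injective (g := r) (DFunLike.congr_fun hr)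
  · have hr : (amalgamMap _ _ _ h).comp r = MonoidHom.id _ := by
      apply PresentedGroup.ext
      intro v
      by_cases hv : v ∈ S₁
      · simp only [MonoidHom.comp_apply, r, raagLift_of, hg₁ v hv]
        exact amalgamMap_of h _ _
      · simp only [MonoidHom.comp_apply, r, raagLift_of, hg₂ v (hor v hv)]
        exact amalgamMap_of h _ _
    exact RightInverse.surjective (g := r) (DFunLike.congr_fun hr)

theorem bbInduceMap_injective (S : Set V) : Injective (bbInduceMap Γ S) := by
  intro x y hxy
  exact Subtype.ext (raagInduceMap_injective Γ S (congrArg Subtype.val hxy))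

/-- The inclusion of A_S preserves height, so H_S is the intersection of A_S with H_Γ, the form in
which kernels of amalgams are treated. -/
theorem bbSubgroup_eq_subgroupOf (S : Set V) :
    bbSubgroup Γ S = (raagInduceMap Γ S).range.subgroupOf (BestvinaBrady Γ) := by
  ext x
  constructor
  · rintro ⟨y, rfl⟩
    exact ⟨y, rfl⟩
  · rintro ⟨y, hy⟩
    refine ⟨⟨y, ?_⟩, Subtype.ext hy⟩
    have hx : raagHeight Γ x = 1 := x.2
    change raagHeight (Γ.induce S) y = 1
    rw [← raagHeight_comp_induceMap, MonoidHom.comp_apply, hy]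
    exact hx

/-- The Bestvina--Brady group of a union of two induced subgraphs with nonempty intersection and no
edges outside of them is the amalgamated product over the group of the intersection. -/
theorem bb_isAmalgam {S₁ S₂ T : Set V} (hT : S₁ ∩ S₂ = T) (hU : S₁ ∪ S₂ = Set.univ)
    (hadj : ∀ v w, Γ.Adj v w → (v ∈ S₁ ∧ w ∈ S₁) ∨ (v ∈ S₂ ∧ w ∈ S₂)) (hne : T.Nonempty) :
    IsAmalgam (bbSubgroup Γ S₁) (bbSubgroup Γ S₂) (bbSubgroup Γ T) := by
  simp only [bbSubgroup_eq_subgroupOf]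
  refine (raag_isAmalgam Γ hT hU hadj).subgroupOf_ker (raagHeight Γ) fun q => ?_
  obtain ⟨v, hv⟩ := hne
  refine ⟨PresentedGroup.of v ^ q.toAdd, zpow_mem (of_mem_range_raagInduceMap Γ hv) _, ?_⟩
  rw [map_zpow, raagHeight_of, ← ofAdd_zsmul]
  simp

/-- The exponent sum of a generator. -/
noncomputable def raagExponent (v : V) : RAAG Γ →* Multiplicative ℤ :=
  open Classical in
  raagLift Γ (Pi.mulSingle v (Multiplicative.ofAdd 1)) fun _ _ _ => Commute.all _ _

theorem raagExponent_of_self (v : V) :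
    raagExponent Γ v (PresentedGroup.of v) = Multiplicative.ofAdd 1 := by
  simp [raagExponent]

theorem raagExponent_of_ne {v w : V} (h : w ≠ v) :
    raagExponent Γ v (PresentedGroup.of w) = 1 := by
  simp [raagExponent, h]

theorem raagExponent_eq_one_of_mem_range {T : Set V} {v : V} (hv : v ∉ T) {x : RAAG Γ}
    (hx : x ∈ (raagInduceMap Γ T).range) : raagExponent Γ v x = 1 := by
  obtain ⟨y, rfl⟩ := hx
  have : (raagExponent Γ v).comp (raagInduceMap Γ T) = 1 := by
    apply PresentedGroup.ext
    intro w
    simp [raagExponent_of_ne Γ (v := v) (w := w) (fun h => hv (h ▸ w.2))]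
  exact DFunLike.congr_fun this y

theorem range_raagInduceMap_ne {S T : Set V} {v : V} (hS : v ∈ S) (hT : v ∉ T) :
    (raagInduceMap Γ S).range ≠ (raagInduceMap Γ T).range := by
  intro h
  have := raagExponent_eq_one_of_mem_range Γ hT (h ▸ of_mem_range_raagInduceMap Γ hS)
  rw [raagExponent_of_self] at this
  exact absurd this (by decide)

/-- A single generator has height 1 and is not in H_Γ; the second vertex `w` corrects this, and v
w⁻¹ still has exponent 1 at `v`. -/
theorem bbSubgroup_ne {S T : Set V} {v w : V} (hS : v ∈ S) (hT : v ∉ T) (hw : w ∈ S)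
    (hvw : w ≠ v) : bbSubgroup Γ S ≠ bbSubgroup Γ T := by
  intro h
  simp only [bbSubgroup_eq_subgroupOf] at h
  let x : BestvinaBrady Γ := ⟨PresentedGroup.of v * (PresentedGroup.of w)⁻¹, by
    simp [BestvinaBrady, MonoidHom.mem_ker]⟩
  have hx : x ∈ (raagInduceMap Γ S).range.subgroupOf (BestvinaBrady Γ) :=
    mul_mem (of_mem_range_raagInduceMap Γ hS) (inv_mem (of_mem_range_raagInduceMap Γ hw))
  rw [h] at hx
  have : raagExponent Γ v (PresentedGroup.of v * (PresentedGroup.of w)⁻¹) = 1 :=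
    raagExponent_eq_one_of_mem_range Γ hT hx
  simp only [map_mul, map_inv, raagExponent_of_self, raagExponent_of_ne Γ hvw] at this
  exact absurd this (by decide)

end RAAG

/-! ### Complete graphs and free abelian groups -/

section Complete

variable {W : Type*} [Fintype W] [DecidableEq W] (Γ : SimpleGraph W)

/-- The homomorphism from the free abelian group to the right-angled Artin group of a finite
complete graph. -/
noncomputable def raagCompleteOfPi (h : ∀ v w, v ≠ w → Γ.Adj v w) :
    (W → Multiplicative ℤ) →* RAAG Γ :=
  MonoidHom.noncommPiCoprod (N := fun _ => Multiplicative ℤ)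
    (fun v => zpowersHom (RAAG Γ) (PresentedGroup.of v))
    (fun v w hvw x y => show Commute (PresentedGroup.of v ^ x.toAdd : RAAG Γ)
      (PresentedGroup.of w ^ y.toAdd) from
        ((raag_commute Γ (h v w hvw)).zpow_left _).zpow_right _)

theorem raagCompleteOfPi_mulSingle (h : ∀ v w, v ≠ w → Γ.Adj v w) (v : W) :
    raagCompleteOfPi Γ h (Pi.mulSingle v (Multiplicative.ofAdd 1)) = PresentedGroup.of v :=
  (MonoidHom.noncommPiCoprod_mulSingle (N := fun _ => Multiplicative ℤ) _ _ _).trans (by simp)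

/-- The right-angled Artin group of a finite complete graph is free abelian. -/
noncomputable def raagCompleteEquiv (h : ∀ v w, v ≠ w → Γ.Adj v w) :
    RAAG Γ ≃* (W → Multiplicative ℤ) :=
  MonoidHom.toMulEquiv
    (raagLift Γ (fun v => Pi.mulSingle v (Multiplicative.ofAdd 1)) fun _ _ _ => Commute.all _ _)
    (raagCompleteOfPi Γ h)
    (by
      apply PresentedGroup.ext
      intro v
      simp [raagCompleteOfPi_mulSingle])
    (by
      apply MonoidHom.functions_ext'
      intro v
      ext1
      simp [raagCompleteOfPi_mulSingle])

theorem prod_raagCompleteEquiv (h : ∀ v w, v ≠ w → Γ.Adj v w) (x : RAAG Γ) :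
    ∏ v, raagCompleteEquiv Γ h x v = raagHeight Γ x := by
  let p : (W → Multiplicative ℤ) →* Multiplicative ℤ :=
    { toFun := fun f => ∏ v, f v, map_one' := by simp, map_mul' := by simp [Finset.prod_mul_distrib] }
  have : p.comp (raagCompleteEquiv Γ h).toMonoidHom = raagHeight Γ := by
    apply PresentedGroup.ext
    intro v
    simp [p, raagCompleteEquiv]
  exact DFunLike.congr_fun this x

theorem nonempty_raag_mulEquiv (h : ∀ v w, v ≠ w → Γ.Adj v w) {n : ℕ} (hn : Fintype.card W = n) :
    Nonempty (RAAG Γ ≃* Multiplicative (Fin n → ℤ)) := by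
  let σ : W ≃ Fin n := Fintype.equivFinOfCardEq hn
  exact ⟨(raagCompleteEquiv Γ h).trans ((MulEquiv.arrowCongr σ (MulEquiv.refl (Multiplicative ℤ))).trans
    (MulEquiv.piMultiplicative fun _ : Fin n => ℤ).symm)⟩

/-- Height is the coordinate sum, so the kernel is the sum-zero hyperplane, and forgetting
coordinate 0 is an isomorphism. -/
theorem nonempty_bestvinaBrady_mulEquiv (h : ∀ v w, v ≠ w → Γ.Adj v w) {m : ℕ}
    (hm : Fintype.card W = m + 1) :
    Nonempty (BestvinaBrady Γ ≃* Multiplicative (Fin m → ℤ)) := by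
  let σ : Fin (m + 1) ≃ W := (Fintype.equivFinOfCardEq hm).symm
  let e := raagCompleteEquiv Γ h
  have hp : ∀ x, e x (σ 0) * ∏ i : Fin m, e x (σ i.succ) = raagHeight Γ x := by
    intro x
    rw [← prod_raagCompleteEquiv Γ h x, ← σ.prod_comp, Fin.prod_univ_succ]
  let F : BestvinaBrady Γ →* (Fin m → Multiplicative ℤ) :=
    { toFun := fun x i => e x (σ i.succ)
      map_one' := by ext; simp
      map_mul' := fun x y => by ext; simp }
  have hF : Function.Bijective F := by
    constructor
    · rw [injective_iff_map_eq_one]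
      intro x hx
      have hi : ∀ i : Fin m, e x (σ i.succ) = 1 := fun i => congrFun hx i
      have h0 := hp x
      rw [show raagHeight Γ x = 1 from x.2] at h0
      simp only [hi, Finset.prod_const_one, mul_one] at h0
      apply Subtype.ext
      apply e.injective
      rw [OneMemClass.coe_one, map_one]
      ext v
      obtain ⟨i, rfl⟩ := σ.surjective v
      refine Fin.cases ?_ (fun i => ?_) i
      · rw [h0, Pi.one_apply]
      · rw [hi, Pi.one_apply]
    · intro f
      -- Coordinate 0 is chosen to make the total height trivial.
      let g : Fin (m + 1) → Multiplicative ℤ := Fin.cons (∏ i, f i)⁻¹ f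
      have hg : ∀ i, e (e.symm (g ∘ σ.symm)) (σ i) = g i := fun i => by simp
      refine ⟨⟨e.symm (g ∘ σ.symm), ?_⟩, ?_⟩
      · change raagHeight Γ _ = 1
        rw [← hp]
        simp only [hg]
        simp [g]
      · ext1 i
        exact (hg i.succ).trans (by simp [g])
  exact ⟨(MulEquiv.ofBijective F hF).trans (MulEquiv.piMultiplicative fun _ : Fin m => ℤ).symm⟩

end Complete

/-! ### Separations of the graph and the main theorem -/

/-- The complement of a separating set is a union of two nonempty parts with no edges between
them. -/
theorem SimpleGraph.exists_separation {V : Type*} (Γ : SimpleGraph V) (K : Set V)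
    (h : ¬ (Γ.induce Kᶜ).Preconnected) :
    ∃ V₁ V₂ : Set V, V₁.Nonempty ∧ V₂.Nonempty ∧ Disjoint V₁ V₂ ∧ V₁ ∪ V₂ = Kᶜ ∧
      ∀ a ∈ V₁, ∀ b ∈ V₂, ¬ Γ.Adj a b := by
  simp only [SimpleGraph.Preconnected, not_forall] at h
  obtain ⟨a, b, hab⟩ := h
  -- `R` is one component; all the others together form the second part.
  let R : Set ↥(Kᶜ) := {x | (Γ.induce Kᶜ).Reachable a x}
  refine ⟨Subtype.val '' R, Subtype.val '' Rᶜ, ⟨a, a, SimpleGraph.Reachable.refl a, rfl⟩,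
    ⟨b, b, hab, rfl⟩, ?_, ?_, ?_⟩
  · exact (Set.disjoint_image_iff Subtype.val_injective).2 disjoint_compl_right
  · rw [← Set.image_union, Set.union_compl_self, Set.image_univ, Subtype.range_coe]
  · rintro _ ⟨x, hx, rfl⟩ _ ⟨y, hy, rfl⟩ hxy
    exact hy (SimpleGraph.Reachable.trans hx (SimpleGraph.Adj.reachable (by simpa using hxy)))

/-- An edge leaving `V₁` can only end in `K`, so each edge lies within one side; this is the
covering that the amalgam theorems require. -/
theorem separation_union {V : Type*} (Γ : SimpleGraph V) {K V₁ V₂ : Set V}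
    (hd : Disjoint V₁ V₂) (hu : V₁ ∪ V₂ = Kᶜ) (hadj : ∀ a ∈ V₁, ∀ b ∈ V₂, ¬ Γ.Adj a b) :
    (V₁ ∪ K) ∩ (V₂ ∪ K) = K ∧ (V₁ ∪ K) ∪ (V₂ ∪ K) = Set.univ ∧
      ∀ v w, Γ.Adj v w → (v ∈ V₁ ∪ K ∧ w ∈ V₁ ∪ K) ∨ (v ∈ V₂ ∪ K ∧ w ∈ V₂ ∪ K) := by
  have hmem : ∀ v, v ∈ K ∨ v ∈ V₁ ∨ v ∈ V₂ := fun v => by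
    by_cases hv : v ∈ K
    · exact Or.inl hv
    · exact Or.inr (hu.symm ▸ hv : v ∈ V₁ ∪ V₂)
  refine ⟨?_, ?_, ?_⟩
  · rw [← Set.inter_union_distrib_right, hd.inter_eq, Set.empty_union]
  · ext v
    have := hmem v
    simp only [Set.mem_union, Set.mem_univ, iff_true]
    tauto
  · intro v w hvw
    have h₁ := hadj v
    have h₂ := hadj w
    have h₃ := hvw.symm
    have hv := hmem v
    have hw := hmem w
    simp only [Set.mem_union]
    grind

theorem mainTheorem3 {V : Type*} [Fintype V] (Γ : SimpleGraph V) (hconn : Γ.Connected)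
    (hsc : SimplyConnectedSpace (geomRealization (flagComplex Γ)))
    (n : ℕ) (hn : 2 ≤ n) (K : Finset V) (hK : IsSeparatingNClique Γ n K) :
    SplitsOverZPow (RAAG Γ) n ∧
    SplitsOverZPow (BestvinaBrady Γ) (n - 1) ∧
    Nonempty (bbSubgroup Γ (K : Set V) ≃* Multiplicative (Fin (n - 1) → ℤ)) ∧
    ∀ V₁ V₂ : Set V, V₁.Nonempty → V₂.Nonempty → Disjoint V₁ V₂ → V₁ ∪ V₂ = (K : Set V)ᶜ →
      (∀ a ∈ V₁, ∀ b ∈ V₂, ¬ Γ.Adj a b) →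
      Function.Injective (bbInduceMap Γ (V₁ ∪ (K : Set V))) ∧
      Function.Injective (bbInduceMap Γ (V₂ ∪ (K : Set V))) ∧
      Function.Injective (bbInduceMap Γ (K : Set V)) ∧
      IsAmalgam (bbSubgroup Γ (V₁ ∪ (K : Set V))) (bbSubgroup Γ (V₂ ∪ (K : Set V)))
        (bbSubgroup Γ (K : Set V)) ∧
      bbSubgroup Γ (V₁ ∪ (K : Set V)) ≠ bbSubgroup Γ (K : Set V) ∧
      bbSubgroup Γ (V₂ ∪ (K : Set V)) ≠ bbSubgroup Γ (K : Set V) := by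
  classical
  obtain ⟨hKn, hsep⟩ := hK
  have hcomplete : ∀ v w : (K : Set V), v ≠ w → (Γ.induce (K : Set V)).Adj v w := by
    intro v w hvw
    exact hKn.isClique v.2 w.2 (fun h => hvw (Subtype.ext h))
  have hcard : Fintype.card (K : Set V) = n := by
    simpa using hKn.card_eq
  obtain ⟨k, hk⟩ : (K : Set V).Nonempty := by
    rw [Finset.coe_nonempty, ← Finset.card_pos, hKn.card_eq]
    omega
  have hA : Nonempty ((raagInduceMap Γ (K : Set V)).range ≃* Multiplicative (Fin n → ℤ)) :=
    (nonempty_raag_mulEquiv _ hcomplete hcard).map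
      (MonoidHom.ofInjective (raagInduceMap_injective Γ (K : Set V))).symm.trans
  have hH : Nonempty (bbSubgroup Γ (K : Set V) ≃* Multiplicative (Fin (n - 1) → ℤ)) :=
    (nonempty_bestvinaBrady_mulEquiv _ hcomplete (m := n - 1) (by omega)).map
      (MonoidHom.ofInjective (bbInduceMap_injective Γ (K : Set V))).symm.trans
  have hnot : ∀ {V₁ V₂ : Set V}, V₁ ∪ V₂ = (K : Set V)ᶜ → ∀ v, v ∈ V₁ ∨ v ∈ V₂ →
      v ∉ (K : Set V) := fun hu v hv => hu.subset hv
  have hne : ∀ {S : Set V} {v : V}, v ∈ S → v ∉ (K : Set V) →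
      bbSubgroup Γ (S ∪ (K : Set V)) ≠ bbSubgroup Γ (K : Set V) := fun hv hvK =>
    bbSubgroup_ne Γ (Or.inl hv) hvK (Or.inr hk) (fun h => hvK (h ▸ hk))
  have hmain : ∀ V₁ V₂ : Set V, V₁.Nonempty → V₂.Nonempty → Disjoint V₁ V₂ →
      V₁ ∪ V₂ = (K : Set V)ᶜ → (∀ a ∈ V₁, ∀ b ∈ V₂, ¬ Γ.Adj a b) →
      IsAmalgam (bbSubgroup Γ (V₁ ∪ (K : Set V))) (bbSubgroup Γ (V₂ ∪ (K : Set V)))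
        (bbSubgroup Γ (K : Set V)) ∧
      bbSubgroup Γ (V₁ ∪ (K : Set V)) ≠ bbSubgroup Γ (K : Set V) ∧
      bbSubgroup Γ (V₂ ∪ (K : Set V)) ≠ bbSubgroup Γ (K : Set V) := by
    rintro V₁ V₂ ⟨a, ha⟩ ⟨b, hb⟩ hd hu hadj
    obtain ⟨h₁, h₂, h₃⟩ := separation_union Γ hd hu hadj
    exact ⟨bb_isAmalgam Γ h₁ h₂ h₃ ⟨k, hk⟩, hne ha (hnot hu a (Or.inl ha)),
      hne hb (hnot hu b (Or.inr hb))⟩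
  obtain ⟨V₁, V₂, ⟨a, ha⟩, ⟨b, hb⟩, hd, hu, hadj⟩ := Γ.exists_separation _ hsep
  obtain ⟨h₁, h₂, h₃⟩ := separation_union Γ hd hu hadj
  obtain ⟨ham, hne₁, hne₂⟩ := hmain V₁ V₂ ⟨a, ha⟩ ⟨b, hb⟩ hd hu hadj
  refine ⟨⟨_, hA, Or.inl ⟨_, _, raag_isAmalgam Γ h₁ h₂ h₃,
      range_raagInduceMap_ne Γ (Or.inl ha) (hnot hu a (Or.inl ha)),
      range_raagInduceMap_ne Γ (Or.inl hb) (hnot hu b (Or.inr hb))⟩⟩,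
    ⟨_, hH, Or.inl ⟨_, _, ham, hne₁, hne₂⟩⟩, hH, ?_⟩
  intro U₁ U₂ hn₁ hn₂ hdU huU hadjU
  exact ⟨bbInduceMap_injective Γ _, bbInduceMap_injective Γ _, bbInduceMap_injective Γ _,
    hmain U₁ U₂ hn₁ hn₂ hdU huU hadjU⟩
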